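/- Let $n$ be a natural number and let $\mathbb{M}_n$ denote the complex $n\times n$ matrices and $\mathbb{M}_n^+$ the positive semidefinite ones. Let $\|\cdot\|$ be a symmetric norm on $\mathbb{M}_n$, i.e. a norm such that $\|UXV\|=\|X\|$ for all $X\in\mathbb{M}_n$ and all unitaries $U,V\in\mathbb{M}_n$. Let $p\in(0,1)$ and $q\in(-\infty,0)$ with $1/p+1/q=1$. Then, for every $A,B\in\mathbb{M}_n^+$, $$ \|AB\|\ \ge\ \|A^p\|^{1/p}\,\|B^q\|^{1/q}, $$ where the powers $A^p$ and $B^q$ are given by the functional calculus, and where $\|B^q\|^{1/q}$ is understood to be $0$ if $B$ is not invertible. -/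

import Mathlib

open scoped ComplexOrder

/-- A symmetric norm on the complex `n × n` matrices: a norm that is unitarily invariant,
`‖U A V‖ = ‖A‖` for all unitaries `U`, `V`. -/
structure IsSymmetricNorm {n : ℕ} (N : Matrix (Fin n) (Fin n) ℂ → ℝ) : Prop where
  nonneg : ∀ A, 0 ≤ N A
  eq_zero : ∀ A, N A = 0 → A = 0
  smul : ∀ (c : ℂ) (A), N (c • A) = ‖c‖ * N A
  add_le : ∀ A B, N (A + B) ≤ N A + N B
  unitary_mul_mul : ∀ U ∈ Matrix.unitaryGroup (Fin n) ℂ, ∀ V ∈ Matrix.unitaryGroup (Fin n) ℂ,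
    ∀ A, N (U * A * V) = N A

/-- The real power `A ^ p` of a positive semidefinite matrix, by functional calculus (apply
`x ↦ x ^ p` to the eigenvalues). For `p < 0` it is only used for invertible `A`. -/
noncomputable def psdPow {n : ℕ} (A : Matrix (Fin n) (Fin n) ℂ) (p : ℝ) :
    Matrix (Fin n) (Fin n) ℂ :=
  cfc (fun x : ℝ => x ^ p) A

open Classical in
/-- The derived anti-norm `‖B ^ q‖ ^ (1 / q)`, for `q < 0`, of a symmetric norm `N`, evaluated at a
positive semidefinite matrix `B`; it is `0` when `B` is not invertible. -/
noncomputable def derivedAntiNorm {n : ℕ} (N : Matrix (Fin n) (Fin n) ℂ → ℝ) (q : ℝ)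
    (B : Matrix (Fin n) (Fin n) ℂ) : ℝ :=
  if IsUnit B then N (psdPow B q) ^ (1 / q) else 0

open Matrix

namespace IsSymmetricNorm

variable {n : ℕ} {N : Matrix (Fin n) (Fin n) ℂ → ℝ}

/-! In an eigenbasis of `A`, `A = diag(a)` and `B = V diag(β) V*`. Let `b`, `c` be the diagonals of
`B` and `B^q`. Pinching gives `‖diag(a b)‖ ≤ ‖AB‖` and `‖diag(c)‖ ≤ ‖B^q‖`. Each `b i`, `c i`
averages `β`, `β^q` with the same weights, so `1 ≤ b^p c^(1-p)` by AM-GM, hence `a^p ≤ (a b)^p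
c^(1-p)` entrywise. Monotonicity and Hölder on diagonal matrices yield `‖A^p‖ ≤ ‖AB‖^p ‖B^q‖^(1-p)`;
the `1/p`-th power is the claim, since `(1-p)/p = -1/q`. -/

lemma map_zero (hN : IsSymmetricNorm N) : N 0 = 0 := by
  simpa using hN.smul 0 0

lemma unitary_mul (hN : IsSymmetricNorm N) {U : Matrix (Fin n) (Fin n) ℂ}
    (hU : U ∈ unitaryGroup (Fin n) ℂ) (A : Matrix (Fin n) (Fin n) ℂ) : N (U * A) = N A := by
  simpa using hN.unitary_mul_mul U hU 1 (one_mem _) A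

/-- A diagonal matrix whose diagonal entries have modulus one is unitary. -/
lemma diagonal_mem_unitaryGroup {d : Fin n → ℂ} (hd : ∀ i, d i * star (d i) = 1) :
    diagonal d ∈ unitaryGroup (Fin n) ℂ := by
  rw [mem_unitaryGroup_iff, star_eq_conjTranspose, diagonal_conjTranspose, diagonal_mul_diagonal,
    ← diagonal_one]
  congr 1
  funext i
  simpa using hd i

/-- The norm of the average of two matrices is at most their common bound. -/
lemma half_add_le (hN : IsSymmetricNorm N) {X Y : Matrix (Fin n) (Fin n) ℂ} {r : ℝ}
    (hX : N X ≤ r) (hY : N Y ≤ r) : N ((1 / 2 : ℂ) • (X + Y)) ≤ r := by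
  rw [hN.smul]
  have := hN.add_le X Y
  norm_num
  linarith

/-- Pinching: passing to the diagonal part does not increase a symmetric norm. -/
lemma diagonal_diag_le (hN : IsSymmetricNorm N) (X : Matrix (Fin n) (Fin n) ℂ) :
    N (diagonal X.diag) ≤ N X := by
  have key : ∀ S : Finset (Fin n),
      N (of fun i j => if i = j ∨ (i ∉ S ∧ j ∉ S) then X i j else 0) ≤ N X := by
    intro S
    induction S using Finset.induction_on with
    | empty =>
      refine le_of_eq (congrArg N ?_)
      ext i j
      simp
    | insert a S ha ih =>
      set Y : Matrix (Fin n) (Fin n) ℂ :=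
        of fun i j => if i = j ∨ (i ∉ S ∧ j ∉ S) then X i j else 0 with hY
      -- Conjugation by this reflection negates exactly the off-diagonal entries of row and column
      -- `a`; averaging with `Y` kills them.
      set d : Fin n → ℂ := fun i => if i = a then -1 else 1 with hd
      have hU : diagonal d ∈ unitaryGroup (Fin n) ℂ :=
        diagonal_mem_unitaryGroup fun i => by by_cases h : i = a <;> simp [hd, h]
      have hle : N (diagonal d * Y * diagonal d) ≤ N X := by
        rwa [hN.unitary_mul_mul _ hU _ hU]
      convert hN.half_add_le ih hle using 2
      ext i j
      simp only [hY, hd, of_apply, Finset.mem_insert, Matrix.smul_apply, Matrix.add_apply,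
        mul_diagonal, diagonal_mul, smul_eq_mul]
      by_cases hij : i = j
      · subst hij
        by_cases hi : i = a <;> simp [hi] <;> ring
      · by_cases hi : i = a
        · have hj : j ≠ a := fun h => hij (hi.trans h.symm)
          simp only [hi, hj, if_true, if_false, false_or]
          split_ifs <;> simp_all
        · by_cases hj : j = a
          · simp [hi, hj]
          · simp only [hij, hi, hj, if_false, false_or]
            ring
  refine le_of_eq_of_le (congrArg N ?_) (key Finset.univ)
  ext i j
  by_cases hij : i = j <;> simp [hij]

/-- A symmetric norm is monotone on nonnegative diagonal matrices. -/
lemma diagonal_mono (hN : IsSymmetricNorm N) {x y : Fin n → ℝ} (hx : ∀ i, 0 ≤ x i)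
    (hxy : ∀ i, x i ≤ y i) :
    N (diagonal fun i => (x i : ℂ)) ≤ N (diagonal fun i => (y i : ℂ)) := by
  -- `x = y cos θ` is the average of `e^{iθ} y` and `e^{-iθ} y`, two unitary multiples of `diag(y)`.
  set θ : Fin n → ℝ := fun i => Real.arccos (x i / y i) with hθ
  have hcos : ∀ i, Real.cos (θ i) * y i = x i := fun i => by
    have hy : 0 ≤ y i := (hx i).trans (hxy i)
    rcases hy.eq_or_lt with h | h
    · have := hx i
      have := hxy i
      rw [← h]
      linarith
    · rw [hθ, Real.cos_arccos (by linarith [div_nonneg (hx i) hy]) ((div_le_one h).2 (hxy i))]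
      field_simp
  have hu : ∀ s : Fin n → ℝ,
      diagonal (fun i => Complex.exp (s i * Complex.I)) ∈ unitaryGroup (Fin n) ℂ := fun s =>
    diagonal_mem_unitaryGroup fun i => by
      rw [Complex.star_def, Complex.mul_conj, Complex.normSq_eq_norm_sq,
        Complex.norm_exp_ofReal_mul_I]
      simp
  have h := hN.half_add_le (hN.unitary_mul (hu θ) (diagonal fun i => (y i : ℂ))).le
    (hN.unitary_mul (hu fun i => -θ i) (diagonal fun i => (y i : ℂ))).le
  refine le_of_eq_of_le (congrArg N ?_) h
  rw [diagonal_mul_diagonal, diagonal_mul_diagonal, diagonal_add, ← diagonal_smul]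
  congr 1
  funext i
  have hc := Complex.two_cos (θ i : ℂ)
  rw [← hcos i]
  push_cast
  simp only [Pi.smul_apply, smul_eq_mul]
  linear_combination (y i : ℂ) / 2 * hc

/-- Hölder's inequality for a symmetric norm on nonnegative diagonal matrices. -/
lemma diagonal_rpow_mul_rpow_le (hN : IsSymmetricNorm N) {p : ℝ} (hp0 : 0 < p) (hp1 : p < 1)
    {x y : Fin n → ℝ} (hx : ∀ i, 0 ≤ x i) (hy : ∀ i, 0 ≤ y i) :
    N (diagonal fun i => ((x i ^ p * y i ^ (1 - p) : ℝ) : ℂ)) ≤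
      N (diagonal fun i => (x i : ℂ)) ^ p * N (diagonal fun i => (y i : ℂ)) ^ (1 - p) := by
  have hp1' : 0 < 1 - p := sub_pos.2 hp1
  set P := N (diagonal fun i => (x i : ℂ)) with hP
  set Q := N (diagonal fun i => (y i : ℂ)) with hQ
  have entry_zero : ∀ z : Fin n → ℝ, N (diagonal fun i => (z i : ℂ)) = 0 → ∀ i, z i = 0 :=
    fun z hz i => by
      have := congrFun (congrFun (hN.eq_zero _ hz) i) i
      simpa using this
  rcases (hN.nonneg _ : 0 ≤ P).eq_or_lt with h | hPpos
  · have hx0 := entry_zero x h.symm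
    refine le_of_eq_of_le ?_
      (mul_nonneg (Real.rpow_nonneg h.le _) (Real.rpow_nonneg (hN.nonneg _) _))
    simp [hx0, Real.zero_rpow hp0.ne', hN.map_zero]
  rcases (hN.nonneg _ : 0 ≤ Q).eq_or_lt with h | hQpos
  · have hy0 := entry_zero y h.symm
    refine le_of_eq_of_le ?_
      (mul_nonneg (Real.rpow_nonneg hPpos.le _) (Real.rpow_nonneg h.le _))
    simp [hy0, Real.zero_rpow hp1'.ne', hN.map_zero]
  set T := P ^ p * Q ^ (1 - p) with hT
  have hTpos : 0 < T := by positivity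
  -- Weighted AM-GM for `x i / P` and `y i / Q`: the right side then has norm at most `T p + T (1 -
  -- p) = T`.
  have hpt : ∀ i, x i ^ p * y i ^ (1 - p) ≤ T * p / P * x i + T * (1 - p) / Q * y i := fun i => by
    have h := Real.geom_mean_le_arith_mean2_weighted hp0.le hp1'.le (div_nonneg (hx i) hPpos.le)
      (div_nonneg (hy i) hQpos.le) (by ring)
    rw [Real.div_rpow (hx i) hPpos.le, Real.div_rpow (hy i) hQpos.le, div_mul_div_comm, ← hT,
      div_le_iff₀ hTpos] at h
    calc _ ≤ _ := h
      _ = _ := by ring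
  refine (hN.diagonal_mono (fun i => mul_nonneg (Real.rpow_nonneg (hx i) _)
    (Real.rpow_nonneg (hy i) _)) hpt).trans ?_
  have hsplit : (diagonal fun i => ((T * p / P * x i + T * (1 - p) / Q * y i : ℝ) : ℂ)) =
      ((T * p / P : ℝ) : ℂ) • (diagonal fun i => (x i : ℂ)) +
        ((T * (1 - p) / Q : ℝ) : ℂ) • diagonal fun i => (y i : ℂ) := by
    rw [← diagonal_smul, ← diagonal_smul, diagonal_add]
    congr 1
    funext i
    simp
  rw [hsplit]
  refine (hN.add_le _ _).trans ?_
  rw [hN.smul, hN.smul, Complex.norm_real, Complex.norm_real, Real.norm_of_nonneg (by positivity),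
    Real.norm_of_nonneg (by positivity), ← hP, ← hQ]
  have hP0 : P ≠ 0 := hPpos.ne'
  have hQ0 : Q ≠ 0 := hQpos.ne'
  rw [div_mul_cancel₀ _ hP0, div_mul_cancel₀ _ hQ0]
  exact le_of_eq (by ring)

end IsSymmetricNorm

/-- A weighted power mean inequality for the exponents `1` and `q = -p / (1 - p)`. -/
lemma one_le_sum_rpow_mul_sum_rpow {ι : Type*} [Fintype ι] {p q : ℝ} (hp0 : 0 < p) (hp1 : p < 1)
    (hpq : q * (1 - p) = -p) {w β : ι → ℝ} (hw : ∀ i, 0 ≤ w i) (hw1 : ∑ i, w i = 1)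
    (hβ : ∀ i, 0 < β i) :
    1 ≤ (∑ i, w i * β i) ^ p * (∑ i, w i * β i ^ q) ^ (1 - p) := by
  have hp1' : 0 < 1 - p := sub_pos.2 hp1
  have hpos : ∀ f : ι → ℝ, (∀ i, 0 < f i) → 0 < ∑ i, w i * f i := fun f hf => by
    obtain ⟨i, -, hi⟩ : ∃ i ∈ Finset.univ, 0 < w i := by
      by_contra! h
      have := Finset.sum_nonpos h
      linarith
    exact Finset.sum_pos' (fun j _ => mul_nonneg (hw j) (hf j).le)
      ⟨i, Finset.mem_univ _, mul_pos hi (hf i)⟩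
  have hb := hpos β hβ
  have hc := hpos (fun i => β i ^ q) fun i => Real.rpow_pos_of_pos (hβ i) _
  set b := ∑ i, w i * β i with hbdef
  set c := ∑ i, w i * β i ^ q with hcdef
  -- AM-GM after normalizing by the means; the numerator is `β^p (β^q)^(1-p) = 1` by `hpq`.
  have hpt : ∀ i, 1 / (b ^ p * c ^ (1 - p)) ≤ p * (β i / b) + (1 - p) * (β i ^ q / c) :=
    fun i => by
      have hβq := Real.rpow_pos_of_pos (hβ i) q
      have h := Real.geom_mean_le_arith_mean2_weighted hp0.le hp1'.le
        (div_nonneg (hβ i).le hb.le) (div_nonneg hβq.le hc.le) (by ring)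
      rwa [Real.div_rpow (hβ i).le hb.le, Real.div_rpow hβq.le hc.le, div_mul_div_comm,
        ← Real.rpow_mul (hβ i).le, hpq, ← Real.rpow_add (hβ i), add_neg_cancel,
        Real.rpow_zero] at h
  have hsum := Finset.sum_le_sum fun i (_ : i ∈ Finset.univ) =>
    mul_le_mul_of_nonneg_left (hpt i) (hw i)
  have hr : ∑ i, w i * (p * (β i / b) + (1 - p) * (β i ^ q / c)) = 1 := by
    calc _ = p / b * ∑ i, w i * β i + (1 - p) / c * ∑ i, w i * β i ^ q := by
          rw [Finset.mul_sum, Finset.mul_sum, ← Finset.sum_add_distrib]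
          exact Finset.sum_congr rfl fun i _ => by ring
      _ = 1 := by
          rw [← hbdef, ← hcdef]
          field_simp
          ring
  rw [← Finset.sum_mul, hw1, one_mul, hr, div_le_one (by positivity)] at hsum
  exact hsum

/-- A Hermitian matrix is simultaneously diagonalized with all its real powers. -/
lemma Matrix.IsHermitian.psdPow_eq {n : ℕ} {A : Matrix (Fin n) (Fin n) ℂ} (hA : A.IsHermitian)
    (p : ℝ) :
    psdPow A p = (hA.eigenvectorUnitary : Matrix (Fin n) (Fin n) ℂ) *
      diagonal (fun i => ((hA.eigenvalues i ^ p : ℝ) : ℂ)) *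
        star (hA.eigenvectorUnitary : Matrix (Fin n) (Fin n) ℂ) := by
  rw [psdPow, hA.cfc_eq, Matrix.IsHermitian.cfc, Unitary.conjStarAlgAut_apply]
  rfl

lemma Matrix.IsHermitian.eq_unitary_mul_diagonal_mul_star {n : ℕ}
    {A : Matrix (Fin n) (Fin n) ℂ} (hA : A.IsHermitian) :
    A = (hA.eigenvectorUnitary : Matrix (Fin n) (Fin n) ℂ) *
      diagonal (fun i => (hA.eigenvalues i : ℂ)) *
        star (hA.eigenvectorUnitary : Matrix (Fin n) (Fin n) ℂ) := by
  conv_lhs => rw [hA.spectral_theorem, Unitary.conjStarAlgAut_apply]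
  rfl

/-- For unitary `V` the weights `|V i k|²` sum to 1 in each row, so this entry is an average of `f`.
-/
lemma mul_diagonal_mul_star_apply_self {n : ℕ} (V : Matrix (Fin n) (Fin n) ℂ) (f : Fin n → ℝ)
    (i : Fin n) :
    (V * diagonal (fun k => (f k : ℂ)) * star V) i i =
      ((∑ k, Complex.normSq (V i k) * f k : ℝ) : ℂ) := by
  rw [mul_apply]
  push_cast
  refine Finset.sum_congr rfl fun k _ => ?_
  rw [mul_diagonal, star_apply, Complex.star_def, Complex.normSq_eq_conj_mul_self]
  ring

/-- **Reverse Hölder inequality** in diagonalized form. -/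
lemma IsSymmetricNorm.diagonal_rpow_le {n : ℕ} {N : Matrix (Fin n) (Fin n) ℂ → ℝ}
    (hN : IsSymmetricNorm N) {p q : ℝ} (hp0 : 0 < p) (hp1 : p < 1) (hpq : q * (1 - p) = -p)
    {V : Matrix (Fin n) (Fin n) ℂ} (hV : V ∈ unitaryGroup (Fin n) ℂ) {a β : Fin n → ℝ}
    (ha : ∀ i, 0 ≤ a i) (hβ : ∀ i, 0 < β i) :
    N (diagonal fun i => ((a i ^ p : ℝ) : ℂ)) ≤
      N (diagonal (fun i => (a i : ℂ)) * (V * diagonal (fun i => (β i : ℂ)) * star V)) ^ p *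
        N (diagonal fun i => ((β i ^ q : ℝ) : ℂ)) ^ (1 - p) := by
  have hp1' : 0 < 1 - p := sub_pos.2 hp1
  set w : Fin n → Fin n → ℝ := fun i k => Complex.normSq (V i k) with hw
  have hw0 : ∀ i k, 0 ≤ w i k := fun i k => Complex.normSq_nonneg _
  have hw1 : ∀ i, ∑ k, w i k = 1 := fun i => by
    have h := mul_diagonal_mul_star_apply_self V (fun _ => 1) i
    simp only [Complex.ofReal_one, diagonal_one, mul_one, mem_unitaryGroup_iff.1 hV,
      one_apply_eq] at h
    exact_mod_cast h.symm
  set b : Fin n → ℝ := fun i => ∑ k, w i k * β k with hb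
  set c : Fin n → ℝ := fun i => ∑ k, w i k * β k ^ q with hc
  have hb0 : ∀ i, 0 ≤ b i := fun i =>
    Finset.sum_nonneg fun k _ => mul_nonneg (hw0 i k) (hβ k).le
  have hc0 : ∀ i, 0 ≤ c i := fun i =>
    Finset.sum_nonneg fun k _ => mul_nonneg (hw0 i k) (Real.rpow_nonneg (hβ k).le _)
  have h1 : N (diagonal fun i => ((a i * b i : ℝ) : ℂ)) ≤
      N (diagonal (fun i => (a i : ℂ)) * (V * diagonal (fun i => (β i : ℂ)) * star V)) := by
    refine le_of_eq_of_le (congrArg N ?_) (hN.diagonal_diag_le _)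
    congr 1
    funext i
    rw [diag_apply, diagonal_mul, mul_diagonal_mul_star_apply_self]
    push_cast [hb, hw]
    rfl
  have h2 : N (diagonal fun i => (c i : ℂ)) ≤ N (diagonal fun i => ((β i ^ q : ℝ) : ℂ)) := by
    rw [← hN.unitary_mul_mul V hV (star V) (Unitary.star_mem hV)
      (diagonal fun i => ((β i ^ q : ℝ) : ℂ))]
    refine le_of_eq_of_le (congrArg N ?_) (hN.diagonal_diag_le _)
    congr 1
    funext i
    rw [diag_apply, mul_diagonal_mul_star_apply_self]
  calc N (diagonal fun i => ((a i ^ p : ℝ) : ℂ))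
      ≤ N (diagonal fun i => (((a i * b i) ^ p * c i ^ (1 - p) : ℝ) : ℂ)) :=
        hN.diagonal_mono (fun i => Real.rpow_nonneg (ha i) _) fun i => by
          rw [Real.mul_rpow (ha i) (hb0 i), mul_assoc]
          exact le_mul_of_one_le_right (Real.rpow_nonneg (ha i) _)
            (one_le_sum_rpow_mul_sum_rpow hp0 hp1 hpq (hw0 i) (hw1 i) hβ)
    _ ≤ _ := hN.diagonal_rpow_mul_rpow_le hp0 hp1 (fun i => mul_nonneg (ha i) (hb0 i)) hc0
    _ ≤ _ := mul_le_mul (Real.rpow_le_rpow (hN.nonneg _) h1 hp0.le)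
        (Real.rpow_le_rpow (hN.nonneg _) h2 hp1'.le) (Real.rpow_nonneg (hN.nonneg _) _)
        (Real.rpow_nonneg (hN.nonneg _) _)

theorem mainTheorem12 {n : ℕ} (N : Matrix (Fin n) (Fin n) ℂ → ℝ) (hN : IsSymmetricNorm N)
    (p q : ℝ) (hp0 : 0 < p) (hp1 : p < 1) (hq : q < 0) (hpq : 1 / p + 1 / q = 1)
    (A B : Matrix (Fin n) (Fin n) ℂ) (hA : A.PosSemidef) (hB : B.PosSemidef) :
    N (psdPow A p) ^ (1 / p) * derivedAntiNorm N q B ≤ N (A * B) := by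
  unfold derivedAntiNorm
  split_ifs with hu
  swap
  · simpa using hN.nonneg _
  have hpq' : q * (1 - p) = -p := by
    have hq' := hq.ne
    have h : q + p = p * q := by
      rwa [div_add_div _ _ hp0.ne' hq', div_eq_one_iff_eq (mul_ne_zero hp0.ne' hq'), one_mul,
        mul_one] at hpq
    linarith
  have hBpos : B.PosDef := hB.posDef_iff_isUnit.2 hu
  set U := hA.isHermitian.eigenvectorUnitary
  set W := hB.isHermitian.eigenvectorUnitary
  set a := hA.isHermitian.eigenvalues
  set β := hB.isHermitian.eigenvalues
  have hNA : N (psdPow A p) = N (diagonal fun i => ((a i ^ p : ℝ) : ℂ)) := by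
    rw [hA.isHermitian.psdPow_eq]
    exact hN.unitary_mul_mul _ U.2 _ (star U).2 _
  have hNB : N (psdPow B q) = N (diagonal fun i => ((β i ^ q : ℝ) : ℂ)) := by
    rw [hB.isHermitian.psdPow_eq]
    exact hN.unitary_mul_mul _ W.2 _ (star W).2 _
  have hNAB : N (A * B) = N (diagonal (fun i => (a i : ℂ)) *
      (((star U * W : unitaryGroup (Fin n) ℂ) : Matrix (Fin n) (Fin n) ℂ) *
        diagonal (fun i => (β i : ℂ)) *
          star ((star U * W : unitaryGroup (Fin n) ℂ) : Matrix (Fin n) (Fin n) ℂ))) := by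
    rw [← hN.unitary_mul_mul _ U.2 _ (star U).2 (diagonal _ * _)]
    congr 1
    conv_lhs => rw [hA.isHermitian.eq_unitary_mul_diagonal_mul_star,
      hB.isHermitian.eq_unitary_mul_diagonal_mul_star]
    have hUU : (U : Matrix (Fin n) (Fin n) ℂ) * star (U : Matrix (Fin n) (Fin n) ℂ) = 1 :=
      mem_unitaryGroup_iff.1 U.2
    simp only [Submonoid.coe_mul, Unitary.coe_star, star_mul, star_star, mul_assoc]
    rw [hUU, mul_one]
  have key := hN.diagonal_rpow_le hp0 hp1 hpq' (star U * W).2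
    (fun i => hA.eigenvalues_nonneg i) (fun i => hBpos.eigenvalues_pos i)
  rw [← hNA, ← hNB, ← hNAB] at key
  -- A vanishing norm (only possible for `n = 0`) is separated because adding exponents needs a
  -- positive base; here `0 ^ (1/q) = 0`.
  rcases (hN.nonneg (psdPow B q)).eq_or_lt with h0 | hR
  · rw [← h0, Real.zero_rpow (one_div_ne_zero hq.ne), mul_zero]
    exact hN.nonneg _
  calc N (psdPow A p) ^ (1 / p) * N (psdPow B q) ^ (1 / q)
      ≤ (N (A * B) ^ p * N (psdPow B q) ^ (1 - p)) ^ (1 / p) * N (psdPow B q) ^ (1 / q) :=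
        mul_le_mul_of_nonneg_right (Real.rpow_le_rpow (hN.nonneg _) key (by positivity))
          (Real.rpow_nonneg hR.le _)
    _ = N (A * B) := by
        rw [Real.mul_rpow (Real.rpow_nonneg (hN.nonneg _) _) (Real.rpow_nonneg hR.le _),
          ← Real.rpow_mul (hN.nonneg _), ← Real.rpow_mul hR.le, mul_one_div_cancel hp0.ne',
          Real.rpow_one, mul_assoc, ← Real.rpow_add hR]
        have he : (1 - p) * (1 / p) + 1 / q = 0 := by
          rw [sub_mul, one_mul, mul_one_div_cancel hp0.ne']
          linarith
        rw [he, Real.rpow_zero, mul_one]
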